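/- \textbf{Setting.} Let $\mathcal H$ be a finite class of hypotheses $h:\mathcal X\to\{0,1\}$, $\mathcal D$ a probability distribution on $\mathcal X$, $d(h,h')=\Pr_{x\sim\mathcal D}(h(x)\ne h'(x))$, and $\pi$ a probability distribution on $\mathcal H$. For $V\subseteq\mathcal H$ with $\pi(V)>0$ let $\pi|_V$ be the conditional distribution of $\pi$ on $V$ and $\Phi(V)=\mathbb E_{h,h'\sim\pi|_V}[d(h,h')]$ with $h,h'$ independent ($\Phi(V)=0$ if $\pi(V)=0$). Put $V_x^+=\{h\in V: h(x)=1\}$, $V_x^-=V\setminus V_x^+$. A point $x\in\mathcal X$ \emph{$\rho$-average splits} $V$ if $$\max\Big\{\tfrac{\pi(V_x^+)^2}{\pi(V)^2}\Phi(V_x^+),\ \tfrac{\pi(V_x^-)^2}{\pi(V)^2}\Phi(V_x^-)\Big\}\le(1-\rho)\,\Phi(V).$$ For a sequence $E=(\{h_1,h_1'\},\dots,\{h_n,h_n'\})$ let $\psi(E)=\sum_i d(h_i,h_i')$, let $E_x^+$ be the subsequence of the pairs with $h_i(x)=h_i'(x)=1$, and $E_x^-$ the subsequence of the pairs with $h_i(x)=h_i'(x)=0$.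 \textbf{Procedure SELECT} (inputs $V$, $\pi$, $x_1,\dots,x_m\in\mathcal X$, $\epsilon>0$, $\delta_0>0$). In rounds $t=1,2,\dots$, with $\hat\rho_t=2^{-t}$: draw a sequence $E'$ of $m_t=\big\lceil \tfrac{48}{\hat\rho_t^2\epsilon}\ln\tfrac4{\delta_0}\big\rceil$ pairs whose entries are independent draws from $\pi|_V$ and set $\hat\Phi_t=\tfrac1{m_t}\psi(E')$; then draw in the same way a fresh sequence $E$ of $n_t=\big\lceil\max\{\tfrac{32}{\hat\rho_t^2\hat\Phi_t},\tfrac{40}{\hat\Phi_t^2}\}\ln\tfrac4{\delta_0}\big\rceil$ pairs; if some $x_i$ satisfies $\tfrac1{n_t}\max\{\psi(E_{x_i}^+),\psi(E_{x_i}^-)\}\le(1-\hat\rho_t)\hat\Phi_t$, halt and return any such $x_i$; otherwise go to the next round. (If $\hat\Phi_t=0$, so that $n_t$ would be infinite, the procedure does not halt.) \textbf{Theorem.} There is an absolute constant $C>0$ such that the following holds. Let $\epsilon,\rho,\delta_0>0$, $0<\delta<1$, let $V\subseteq\mathcal H$ with $\pi(V)>0$ satisfy $\Phi(V)\ge\epsilon$,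 let at least one of the points $x_1,\dots,x_m$ $\rho$-average split $V$ (so that $\rho\le1$), and let $\delta_0\le\delta/(2m(2+\log_2(1/\rho)))$. Then with probability at least $1-\delta$ all of the following hold: SELECT halts; every point that it may return, however it chooses among the points passing its test, $(\rho/8)$-average splits $V$; it halts within at most $\lceil\log_2(1/\rho)\rceil+1$ rounds; and it samples in total at most $$C\left(\frac1{\epsilon\rho^2}+\frac{1+\log_2(1/\rho)}{\Phi(V)^2}\right)\ln\frac1{\delta_0}$$ hypotheses. (For $\rho\le 1/2$ one has $1+\log_2(1/\rho)\le2\log_2(1/\rho)$, so this is $O\big((\tfrac1{\epsilon\rho^2}+\tfrac{\log(1/\rho)}{\Phi(V)^2})\log\tfrac1{\delta_0}\big)$.) -/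

import Mathlib

open MeasureTheory ProbabilityTheory

noncomputable section

namespace QuerySelection

variable {X H : Type*} [MeasurableSpace X] [MeasurableSpace H]

/-- The hypothesis distance `d(h, h') = Pr_{x ∼ D}(h(x) ≠ h'(x))`.  A binary hypothesis class is
given by a type `H` of hypotheses and the map `f`, where `f h x` is the label that the hypothesis
`h` gives to the data point `x` (`true` is the label `1`). -/
def hypDist (D : Measure X) (f : H → X → Bool) (h h' : H) : ℝ :=
  D.real {x | f h x ≠ f h' x}

/-- The law of a pair `(h, h')` of two independent draws from the conditional distribution `π|_V`. -/
def pairLaw (π : Measure H) (V : Set H) : Measure (H × H) :=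
  (π[|V]).prod (π[|V])

/-- The average diameter `Φ(V) = E_{h, h' ∼ π|_V} [d(h, h')]` (equal to `0` if `π(V) = 0`). -/
def avgDiam (D : Measure X) (f : H → X → Bool) (π : Measure H) (V : Set H) : ℝ :=
  ∫ e, hypDist D f e.1 e.2 ∂(pairLaw π V)

/-- `V_x^+`, the hypotheses of `V` that label `x` by `1`. -/
def plusPart (f : H → X → Bool) (V : Set H) (x : X) : Set H := {h ∈ V | f h x = true}

/-- `V_x^- = V \ V_x^+`. -/
def minusPart (f : H → X → Bool) (V : Set H) (x : X) : Set H := V \ plusPart f V x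

/-- The data point `x` `ρ`-average splits `V`. -/
def AvgSplits (D : Measure X) (f : H → X → Bool) (π : Measure H) (ρ : ℝ) (V : Set H) (x : X) :
    Prop :=
  max (π.real (plusPart f V x) ^ 2 / π.real V ^ 2 * avgDiam D f π (plusPart f V x))
      (π.real (minusPart f V x) ^ 2 / π.real V ^ 2 * avgDiam D f π (minusPart f V x))
    ≤ (1 - ρ) * avgDiam D f π V

/-- `ψ(E) = ∑_i d(h_i, h'_i)` for the edge sequence `E = (e_i)_{i ∈ I}`, `e_i = {h_i, h'_i}`. -/
def psi (D : Measure X) (f : H → X → Bool) (I : Finset ℕ) (e : ℕ → H × H) : ℝ :=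
  ∑ i ∈ I, hypDist D f (e i).1 (e i).2

/-- The positions of the edges of `E_x^+`: both endpoints label `x` by `1`. -/
def edgesPlus (f : H → X → Bool) (I : Finset ℕ) (e : ℕ → H × H) (x : X) : Finset ℕ :=
  I.filter fun i => f (e i).1 x = true ∧ f (e i).2 x = true

/-- The positions of the edges of `E_x^-`: neither endpoint labels `x` by `1`. -/
def edgesMinus (f : H → X → Bool) (I : Finset ℕ) (e : ℕ → H × H) (x : X) : Finset ℕ :=
  I.filter fun i => f (e i).1 x = false ∧ f (e i).2 x = false

/-- The randomness of SELECT: `ω.1 (t, i)` is the `i`-th pair available for the sequence `E'` of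
round `t`, and `ω.2 (t, i)` is the `i`-th pair available for the sequence `E` of round `t`.
Round `t` draws the first `m_t` of the former and the first `n_t` of the latter. -/
abbrev Draws (H : Type*) : Type _ := (ℕ × ℕ → H × H) × (ℕ × ℕ → H × H)

/-- All the pairs that SELECT draws are independent, with law `(π|_V) × (π|_V)`. -/
def drawsLaw (π : Measure H) [IsProbabilityMeasure π] (V : Set H) (hV : π V ≠ 0) :
    Measure (Draws H) :=
  haveI : IsProbabilityMeasure (π[|V]) := cond_isProbabilityMeasure hV
  haveI : IsProbabilityMeasure (pairLaw π V) := by unfold pairLaw; infer_instance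
  (Measure.infinitePi fun _ : ℕ × ℕ => pairLaw π V).prod
    (Measure.infinitePi fun _ : ℕ × ℕ => pairLaw π V)

/-- `ρ̂_t`, which starts at `ρ̂_1 = 1/2` and is halved after every round. -/
def rhoHat (t : ℕ) : ℝ := (1 / 2) ^ t

/-- `m_t = ⌈48 / (ρ̂_t² ε) · log (4 / δ₀)⌉`. -/
def sizeM (ε δ₀ : ℝ) (t : ℕ) : ℕ :=
  ⌈48 / (rhoHat t ^ 2 * ε) * Real.log (4 / δ₀)⌉₊

/-- The empirical estimate `Φ̂_t = ψ(E') / m_t`. -/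
def phiHat (D : Measure X) (f : H → X → Bool) (ε δ₀ : ℝ) (ω : Draws H) (t : ℕ) : ℝ :=
  psi D f (Finset.range (sizeM ε δ₀ t)) (fun i => ω.1 (t, i)) / sizeM ε δ₀ t

/-- `n_t = ⌈max {32 / (ρ̂_t² Φ̂_t), 40 / Φ̂_t²} · log (4 / δ₀)⌉`.  (Only used when `Φ̂_t > 0`.) -/
def sizeN (D : Measure X) (f : H → X → Bool) (ε δ₀ : ℝ) (ω : Draws H) (t : ℕ) : ℕ :=
  ⌈max (32 / (rhoHat t ^ 2 * phiHat D f ε δ₀ ω t)) (40 / phiHat D f ε δ₀ ω t ^ 2) *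
    Real.log (4 / δ₀)⌉₊

/-- In round `t` the data point `x` passes the test
`(1 / n_t) max {ψ(E_x^+), ψ(E_x^-)} ≤ (1 - ρ̂_t) Φ̂_t`. -/
def Passes (D : Measure X) (f : H → X → Bool) (ε δ₀ : ℝ) (ω : Draws H) (t : ℕ) (x : X) : Prop :=
  1 / (sizeN D f ε δ₀ ω t : ℝ) *
      max (psi D f (edgesPlus f (Finset.range (sizeN D f ε δ₀ ω t)) (fun i => ω.2 (t, i)) x)
            (fun i => ω.2 (t, i)))
          (psi D f (edgesMinus f (Finset.range (sizeN D f ε δ₀ ω t)) (fun i => ω.2 (t, i)) x)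
            (fun i => ω.2 (t, i)))
    ≤ (1 - rhoHat t) * phiHat D f ε δ₀ ω t

/-- On the draws `ω`, SELECT halts in round `t` of the rounds `1, 2, …`: some data point passes the
test of round `t`, and none passes the test of an earlier round.  If `Φ̂_s = 0` in some round
`s` then the prescribed sample size `n_s` is infinite, and SELECT never leaves that round. -/
def HaltsAt (D : Measure X) (f : H → X → Bool) (ε δ₀ : ℝ) {m : ℕ} (x : Fin m → X) (ω : Draws H)
    (t : ℕ) : Prop :=
  1 ≤ t ∧ (∀ s ∈ Finset.Icc 1 t, 0 < phiHat D f ε δ₀ ω s) ∧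
    (∀ s ∈ Finset.Ico 1 t, ∀ i, ¬ Passes D f ε δ₀ ω s (x i)) ∧ ∃ i, Passes D f ε δ₀ ω t (x i)

/-- On the draws `ω`, SELECT halts in round `t` and may return the data point `x i`.  The procedure
does not say which of the points that pass the test of the last round is returned. -/
def Returns (D : Measure X) (f : H → X → Bool) (ε δ₀ : ℝ) {m : ℕ} (x : Fin m → X) (ω : Draws H)
    (t : ℕ) (i : Fin m) : Prop :=
  HaltsAt D f ε δ₀ x ω t ∧ Passes D f ε δ₀ ω t (x i)

/-- The number of hypotheses drawn in the rounds `1, …, t`: a pair counts as two. -/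
def numSampled (D : Measure X) (f : H → X → Bool) (ε δ₀ : ℝ) (ω : Draws H) (t : ℕ) : ℕ :=
  ∑ s ∈ Finset.Icc 1 t, 2 * (sizeM ε δ₀ s + sizeN D f ε δ₀ ω s)

end QuerySelection

end

/-! For each label `b`, the quantity in the definition of average splitting is the mean, under
`pairLaw π V`, of the distance of a pair counted only when both endpoints label `x` by `b`
(`integral_edgeWeight`). The test of SELECT is the empirical version of that definition, with `Φ`
replaced by its estimate, so Chernoff bounds apply.

With `s = ρ̂_t`, three kinds of failure matter in a round. The estimate may have relative error at
least `s/4` (`measureReal_not_accurate_le`). Given an accurate estimate, a point that does not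
`(s/2)`-average split may pass (`measureReal_false_pass_le`), or one that `2s`-average splits may
fail (`measureReal_false_fail_le`). The sample size of the test is random, but it depends only on
the first family of draws. Conditioning on that family makes it a constant.

Let `T = ⌈log₂(1/ρ)⌉ + 1`. Then `2ρ̂_T ≤ ρ`, so the given splitting point should pass in round `T`,
and `ρ̂_t ≥ ρ/4` for `t ≤ T`, so a point passing by then should `(ρ/8)`-average split. A union bound
needs accuracy and no false pass in all `T` rounds, but no false failure only in round `T`. The
geometric growth of `1/ρ̂_t²` keeps a factor `T` out of the `1/(ερ²)` term of the cost. -/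

namespace QuerySelection

/-! ### Chernoff bounds for independent copies of a bounded variable -/

section Concentration

variable {α ι : Type*} [MeasurableSpace α] {ν : Measure α} [IsProbabilityMeasure ν] {Y : α → ℝ}

/-- The moment generating function of a `[0, 1]`-valued variable is at most that of a Poisson
variable with the same mean. -/
lemma integral_exp_mul_le (hY : Measurable Y) (h0 : ∀ a, 0 ≤ Y a) (h1 : ∀ a, Y a ≤ 1) (l : ℝ) :
    ∫ a, Real.exp (l * Y a) ∂ν ≤ Real.exp ((∫ a, Y a ∂ν) * (Real.exp l - 1)) := by
  have hYi : Integrable Y ν :=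
    Integrable.of_bound hY.aestronglyMeasurable 1
      (.of_forall fun a => by rw [Real.norm_eq_abs, abs_le]; constructor <;> linarith [h0 a, h1 a])
  have hpt : ∀ a, Real.exp (l * Y a) ≤ 1 + Y a * (Real.exp l - 1) := fun a => by
    have h := convexOn_exp.2 (Set.mem_univ 0) (Set.mem_univ l) (sub_nonneg.2 (h1 a)) (h0 a)
      (by ring)
    simp only [smul_eq_mul, mul_zero, zero_add, Real.exp_zero, mul_one] at h
    rw [mul_comm l]
    linarith
  have hei : Integrable (fun a => Real.exp (l * Y a)) ν :=
    ((integrable_const (1 : ℝ)).add (hYi.mul_const (Real.exp l - 1))).mono'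
      (by fun_prop) (.of_forall fun a => by
        rw [Real.norm_eq_abs, abs_of_pos (Real.exp_pos _)]; exact hpt a)
  calc ∫ a, Real.exp (l * Y a) ∂ν
      ≤ ∫ a, (1 + Y a * (Real.exp l - 1)) ∂ν :=
        integral_mono hei ((integrable_const _).add (hYi.mul_const _)) hpt
    _ = (∫ a, Y a ∂ν) * (Real.exp l - 1) + 1 := by
        rw [integral_add (integrable_const _) (hYi.mul_const _), integral_mul_const]
        simp [add_comm]
    _ ≤ _ := Real.add_one_le_exp _

/-- Chernoff's bound for sums of independent copies of a `[0, 1]`-valued variable. -/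
lemma measureReal_le_exp_of_iid (hY : Measurable Y) (h0 : ∀ a, 0 ≤ Y a) (h1 : ∀ a, Y a ≤ 1)
    {g : ℕ → ι} (hg : g.Injective) (n : ℕ) (l a : ℝ) :
    (Measure.infinitePi fun _ : ι => ν).real
        {b | l * a ≤ l * ∑ i ∈ Finset.range n, Y (b (g i))} ≤
      Real.exp (n * ((∫ a, Y a ∂ν) * (Real.exp l - 1)) - l * a) := by
  set P := Measure.infinitePi fun _ : ι => ν
  -- The tilt `l` is absorbed into the variables and the moment generating function is taken at `1`.
  -- The sign of `l` then selects the upper or the lower tail.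
  let Z : ℕ → (ι → α) → ℝ := fun i b => l * Y (b (g i))
  have hZm : ∀ i, Measurable (Z i) := fun i => by
    simp only [Z]; fun_prop
  have hind : iIndepFun Z P := by
    have h := iIndepFun_infinitePi (P := fun _ : ι => ν) (X := fun _ a => l * Y a)
      (fun _ => hY.const_mul l)
    exact h.precomp hg
  have hmgf : ∀ i, mgf (Z i) P 1 ≤ Real.exp ((∫ a, Y a ∂ν) * (Real.exp l - 1)) := fun i => by
    refine le_trans (le_of_eq ?_) (integral_exp_mul_le hY h0 h1 l)
    have hmp := measurePreserving_eval_infinitePi (fun _ : ι => ν) (g i)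
    rw [← hmp.map_eq, integral_map hmp.measurable.aemeasurable (by fun_prop)]
    simp [mgf, Z, P]
  have hint : Integrable (fun b => Real.exp (1 * (∑ i ∈ Finset.range n, Z i) b)) P := by
    refine Integrable.of_bound (C := Real.exp (n * |l|)) (by fun_prop) (.of_forall fun b => ?_)
    rw [Real.norm_eq_abs, abs_of_pos (Real.exp_pos _), one_mul, Finset.sum_apply]
    refine Real.exp_le_exp.2 ((Finset.sum_le_card_nsmul _ _ |l| fun i _ => ?_).trans_eq (by simp))
    calc Z i b ≤ |l| * Y (b (g i)) := mul_le_mul_of_nonneg_right (le_abs_self l) (h0 _)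
      _ ≤ |l| := mul_le_of_le_one_right (abs_nonneg l) (h1 _)
  have h := measure_ge_le_exp_mul_mgf (μ := P) (l * a) zero_le_one hint
  rw [hind.mgf_sum hZm] at h
  have hset : {b | l * a ≤ (∑ i ∈ Finset.range n, Z i) b} =
      {b | l * a ≤ l * ∑ i ∈ Finset.range n, Y (b (g i))} := by
    ext b; simp [Z, Finset.sum_apply, Finset.mul_sum]
  rw [hset] at h
  refine h.trans ?_
  have hprod : ∏ i ∈ Finset.range n, mgf (Z i) P 1 ≤
      Real.exp ((∫ a, Y a ∂ν) * (Real.exp l - 1)) ^ n :=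
    (Finset.prod_le_prod (fun _ _ => mgf_nonneg) fun i _ => hmgf i).trans_eq (by simp)
  calc Real.exp (-1 * (l * a)) * ∏ i ∈ Finset.range n, mgf (Z i) P 1
      ≤ Real.exp (-1 * (l * a)) * Real.exp ((∫ a, Y a ∂ν) * (Real.exp l - 1)) ^ n := by gcongr
    _ = _ := by rw [← Real.exp_nat_mul, ← Real.exp_add]; congr 1; ring

/-- The cubic Taylor remainder is at most `2/9 |l|³`, and `1/2 + 2/9 < 3/4`. -/
lemma exp_le_quadratic {l : ℝ} (h : |l| ≤ 1) : Real.exp l ≤ 1 + l + 3 / 4 * l ^ 2 := by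
  have h3 := (abs_le.1 (Real.exp_bound h (n := 3) (by norm_num))).2
  norm_num [Finset.sum_range_succ, Nat.factorial] at h3
  have : |l| ^ 3 ≤ l ^ 2 := by
    rw [← sq_abs l]; exact pow_le_pow_of_le_one (abs_nonneg l) h (by norm_num)
  nlinarith [sq_nonneg l]

/-- Since `exp l ≥ 1 + l + l²/2`, it suffices that `(1 - l + l²/2)(1 + l + l²/2) = 1 + l⁴/4 ≥ 1`. -/
lemma exp_neg_le_quadratic {l : ℝ} (h : 0 ≤ l) : Real.exp (-l) ≤ 1 - l + l ^ 2 / 2 := by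
  have h1 := Real.quadratic_le_exp_of_nonneg h
  rw [Real.exp_neg, inv_le_iff_one_le_mul₀ (Real.exp_pos l)]
  nlinarith [sq_nonneg (l ^ 2), sq_nonneg (l - 1)]

end Concentration

lemma measureReal_prod_le_of_slice {α β : Type*} [MeasurableSpace α] [MeasurableSpace β]
    {μ : Measure α} {ν : Measure β} [IsProbabilityMeasure μ] [IsProbabilityMeasure ν]
    {S : Set (α × β)} (hS : MeasurableSet S) {η : ℝ} (hη : 0 ≤ η)
    (h : ∀ a, ν.real {b | (a, b) ∈ S} ≤ η) : (μ.prod ν).real S ≤ η := by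
  rw [measureReal_def, Measure.prod_apply hS]
  refine ENNReal.toReal_le_of_le_ofReal hη ?_
  calc ∫⁻ a, ν (Prod.mk a ⁻¹' S) ∂μ ≤ ∫⁻ _, ENNReal.ofReal η ∂μ :=
        lintegral_mono fun a => (ENNReal.le_ofReal_iff_toReal_le (measure_ne_top _ _) hη).2 (h a)
    _ = ENNReal.ofReal η := by simp

/-! ### Means over pairs confined to a part of `V` -/

section Means

variable {X H : Type*} [MeasurableSpace H] {π : Measure H} [IsProbabilityMeasure π]

lemma isProbabilityMeasure_pairLaw {V : Set H} (hV : π V ≠ 0) :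
    IsProbabilityMeasure (pairLaw π V) := by
  have := cond_isProbabilityMeasure hV
  unfold pairLaw
  infer_instance

lemma cond_restrict (V : Set H) {A : Set H} (hA : MeasurableSet A) :
    (π[|V]).restrict A = ((π V)⁻¹ * π (V ∩ A)) • π[|V ∩ A] := by
  rw [ProbabilityTheory.cond, ProbabilityTheory.cond, Measure.restrict_smul,
    Measure.restrict_restrict hA, Set.inter_comm A V, smul_smul]
  rcases eq_or_ne (π (V ∩ A)) 0 with h | h
  · rw [Measure.restrict_eq_zero.2 h]; simp
  · rw [mul_assoc, ENNReal.mul_inv_cancel h (measure_ne_top _ _), mul_one]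

/-- Each of the two independent endpoints contributes one factor `π(V ∩ A)/π(V)`, which produces the
squares in the definition of average splitting. -/
lemma setIntegral_pairLaw (V : Set H) {A : Set H} (hA : MeasurableSet A) (g : H × H → ℝ) :
    ∫ e in A ×ˢ A, g e ∂(pairLaw π V) =
      π.real (V ∩ A) ^ 2 / π.real V ^ 2 * ∫ e, g e ∂(pairLaw π (V ∩ A)) := by
  rw [pairLaw, ← Measure.prod_restrict, cond_restrict V hA, Measure.prod_smul_left,
    Measure.prod_smul_right, integral_smul_measure, integral_smul_measure, pairLaw,
    ENNReal.toReal_mul, ENNReal.toReal_inv]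
  simp only [smul_eq_mul, measureReal_def]
  ring

end Means

/-! ### Chernoff exponents -/

/-- The tilt `|l| = s/6` minimises `3l²/4 - |l|s/4`. The minimum `-s²/48` explains the `48` in
`m_t`. -/
lemma exponent_estimate_le {l s Φ a L M : ℝ} (hs0 : 0 < s) (hs1 : s ≤ 1) (hΦ : 0 ≤ Φ)
    (hM0 : 0 ≤ M) (hM : 48 * L ≤ M * s ^ 2 * Φ)
    (hl : l = s / 6 ∧ a = M * (Φ + Φ * s / 4) ∨ l = -(s / 6) ∧ a = M * (Φ - Φ * s / 4)) :
    M * (Φ * (Real.exp l - 1)) - l * a ≤ -L := by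
  have hexp : Real.exp l ≤ 1 + l + 3 / 4 * l ^ 2 := by
    apply exp_le_quadratic
    rcases hl with ⟨rfl, -⟩ | ⟨rfl, -⟩ <;> rw [abs_le] <;> constructor <;> linarith
  have h1 : M * (Φ * (Real.exp l - 1)) ≤ M * (Φ * (l + 3 / 4 * l ^ 2)) := by
    gcongr; linarith
  rcases hl with ⟨rfl, rfl⟩ | ⟨rfl, rfl⟩ <;> nlinarith

/-- The threshold `(1 - s)v` is at most `(1 - 3s/4)Φ`, while the mean is at least `(1 - s/2)Φ`. The
gap `sΦ/4` is balanced against `l²Φ/2` at `|l| = s/4`, which gives the rate `s²Φ/32` and the `32` in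
`n_t`. -/
lemma exponent_lower_le {s Φ p v n L : ℝ} (hs0 : 0 < s) (hs1 : s ≤ 1 / 2) (hΦ : 0 < Φ)
    (hp : (1 - s / 2) * Φ ≤ p) (hv : v ≤ Φ + Φ * s / 4) (hn0 : 0 ≤ n)
    (hn : 32 * L ≤ n * s ^ 2 * v) :
    n * (p * (Real.exp (-(s / 4)) - 1)) - -(s / 4) * (n * ((1 - s) * v)) ≤ -L := by
  have hexp := exp_neg_le_quadratic (l := s / 4) (by linarith)
  have hneg : Real.exp (-(s / 4)) - 1 ≤ 0 := by
    rw [sub_nonpos, Real.exp_le_one_iff]; linarith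
  have h1 : p * (Real.exp (-(s / 4)) - 1) ≤ (1 - s / 2) * Φ * (-(s / 4) + (s / 4) ^ 2 / 2) :=
    calc p * (Real.exp (-(s / 4)) - 1) ≤ (1 - s / 2) * Φ * (Real.exp (-(s / 4)) - 1) :=
          mul_le_mul_of_nonpos_right hp hneg
      _ ≤ _ := mul_le_mul_of_nonneg_left (by linarith) (mul_nonneg (by linarith) hΦ.le)
  have h2 : s / 4 * ((1 - s) * v) ≤ s / 4 * ((1 - s) * (Φ + Φ * s / 4)) := by
    gcongr; linarith
  -- The guarantee on `n` involves `v`, so the rate must beat `s²v/32` at the largest admissible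
  -- `v`. The cubic terms in `s` pay for this.
  have h3 : p * (Real.exp (-(s / 4)) - 1) + s / 4 * ((1 - s) * v) ≤
      -(s ^ 2 * (Φ + Φ * s / 4) / 32) := by
    have : 0 ≤ Φ * s ^ 3 := by positivity
    nlinarith
  have h4 : 32 * L ≤ n * s ^ 2 * (Φ + Φ * s / 4) := hn.trans (by gcongr)
  have h5 := mul_le_mul_of_nonneg_left h3 hn0
  linarith

/-- Here the threshold exceeds the mean by at least `3sΦ/4`, so the tilt `s/4` suffices without
being optimised. -/
lemma exponent_upper_le {s Φ p v n L : ℝ} (hs0 : 0 < s) (hs1 : s ≤ 1 / 2) (hΦ : 0 < Φ)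
    (hp : p ≤ (1 - 2 * s) * Φ) (hv : Φ - Φ * s / 4 ≤ v) (hv' : v ≤ Φ + Φ * s / 4) (hn0 : 0 ≤ n)
    (hn : 32 * L ≤ n * s ^ 2 * v) :
    n * (p * (Real.exp (s / 4) - 1)) - s / 4 * (n * ((1 - s) * v)) ≤ -L := by
  have hexp := exp_le_quadratic (l := s / 4) (by rw [abs_le]; constructor <;> linarith)
  have hpos : 0 ≤ Real.exp (s / 4) - 1 := by
    rw [sub_nonneg, Real.one_le_exp_iff]; linarith
  have h1 : p * (Real.exp (s / 4) - 1) ≤ (1 - 2 * s) * Φ * (s / 4 + 3 / 4 * (s / 4) ^ 2) :=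
    calc p * (Real.exp (s / 4) - 1) ≤ (1 - 2 * s) * Φ * (Real.exp (s / 4) - 1) :=
          mul_le_mul_of_nonneg_right hp hpos
      _ ≤ _ := mul_le_mul_of_nonneg_left (by linarith) (mul_nonneg (by linarith) hΦ.le)
  have h2 : s / 4 * ((1 - s) * (Φ - Φ * s / 4)) ≤ s / 4 * ((1 - s) * v) := by
    gcongr; linarith
  have h3 : p * (Real.exp (s / 4) - 1) - s / 4 * ((1 - s) * v) ≤
      -(s ^ 2 * (Φ + Φ * s / 4) / 32) := by
    have h3' : 0 ≤ Φ * s ^ 3 := by positivity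
    have h2' : 0 ≤ Φ * s ^ 2 * (1 / 2 - s) := mul_nonneg (by positivity) (by linarith)
    nlinarith
  have h4 : 32 * L ≤ n * s ^ 2 * (Φ + Φ * s / 4) := hn.trans (by gcongr)
  have h5 := mul_le_mul_of_nonneg_left h3 hn0
  linarith

/-! ### The failure events of one round -/

section Round

variable {X H : Type*} [MeasurableSpace X] [Fintype H] [MeasurableSpace H]
  [DiscreteMeasurableSpace H] {D : Measure X} {f : H → X → Bool} {π : Measure H}
  [IsProbabilityMeasure π] {V : Set H} {ε δ₀ : ℝ} {t : ℕ}

lemma hypDist_nonneg (h h' : H) : 0 ≤ hypDist D f h h' := measureReal_nonneg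

lemma hypDist_le_one [IsProbabilityMeasure D] (h h' : H) : hypDist D f h h' ≤ 1 :=
  measureReal_le_one

lemma avgDiam_nonneg (V : Set H) : 0 ≤ avgDiam D f π V :=
  integral_nonneg fun _ => hypDist_nonneg _ _

lemma avgDiam_le_one [IsProbabilityMeasure D] (hV : π V ≠ 0) : avgDiam D f π V ≤ 1 := by
  have := isProbabilityMeasure_pairLaw hV
  calc avgDiam D f π V ≤ ∫ _, (1 : ℝ) ∂(pairLaw π V) :=
        integral_mono_of_nonneg (.of_forall fun _ => hypDist_nonneg _ _) (integrable_const _)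
          (.of_forall fun _ => hypDist_le_one _ _)
    _ = 1 := by simp

/-- The contribution of the edge `e` to `ψ(E_x^+)` (for `b = true`) or `ψ(E_x^-)` (for
`b = false`). -/
def edgeWeight (D : Measure X) (f : H → X → Bool) (x : X) (b : Bool) (e : H × H) : ℝ :=
  if f e.1 x = b ∧ f e.2 x = b then hypDist D f e.1 e.2 else 0

lemma edgeWeight_nonneg (x : X) (b : Bool) (e : H × H) : 0 ≤ edgeWeight D f x b e := by
  unfold edgeWeight; split_ifs
  exacts [hypDist_nonneg _ _, le_rfl]

lemma edgeWeight_le_one [IsProbabilityMeasure D] (x : X) (b : Bool) (e : H × H) :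
    edgeWeight D f x b e ≤ 1 := by
  unfold edgeWeight; split_ifs
  exacts [hypDist_le_one _ _, zero_le_one]

lemma psi_edgesPlus (I : Finset ℕ) (e : ℕ → H × H) (x : X) :
    psi D f (edgesPlus f I e x) e = ∑ i ∈ I, edgeWeight D f x true (e i) := by
  simp [psi, edgesPlus, edgeWeight, Finset.sum_filter]

lemma psi_edgesMinus (I : Finset ℕ) (e : ℕ → H × H) (x : X) :
    psi D f (edgesMinus f I e x) e = ∑ i ∈ I, edgeWeight D f x false (e i) := by
  simp [psi, edgesMinus, edgeWeight, Finset.sum_filter]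

lemma integral_edgeWeight (V : Set H) (x : X) (b : Bool) :
    ∫ e, edgeWeight D f x b e ∂(pairLaw π V) =
      π.real {h ∈ V | f h x = b} ^ 2 / π.real V ^ 2 * avgDiam D f π {h ∈ V | f h x = b} := by
  have hA : MeasurableSet {h : H | f h x = b} := .of_discrete
  have h := setIntegral_pairLaw (π := π) V hA (fun e => hypDist D f e.1 e.2)
  rw [← integral_indicator (hA.prod hA)] at h
  rw [show {h ∈ V | f h x = b} = V ∩ {h | f h x = b} from rfl, avgDiam, ← h]
  refine integral_congr_ae (.of_forall fun e => ?_)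
  simp [edgeWeight, Set.indicator_apply]

/-- This and `passes_iff` put the definition and the test in parallel form: a mean and an empirical
sum of the same variable, for each label. -/
lemma avgSplits_iff {ρ : ℝ} {x : X} :
    AvgSplits D f π ρ V x ↔ ∀ b, ∫ e, edgeWeight D f x b e ∂(pairLaw π V) ≤
      (1 - ρ) * avgDiam D f π V := by
  have hm : minusPart f V x = {h ∈ V | f h x = false} := by
    ext h; simp [minusPart, plusPart]
  rw [AvgSplits, max_le_iff, hm, Bool.forall_bool, integral_edgeWeight, integral_edgeWeight,
    and_comm]
  rfl

lemma passes_iff {ω : Draws H} {x : X} (hN : 0 < sizeN D f ε δ₀ ω t) :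
    Passes D f ε δ₀ ω t x ↔ ∀ b,
      ∑ i ∈ Finset.range (sizeN D f ε δ₀ ω t), edgeWeight D f x b (ω.2 (t, i)) ≤
        sizeN D f ε δ₀ ω t * ((1 - rhoHat t) * phiHat D f ε δ₀ ω t) := by
  rw [Passes, psi_edgesPlus, psi_edgesMinus, one_div, inv_mul_le_iff₀ (by exact_mod_cast hN),
    max_le_iff, Bool.forall_bool, and_comm]

lemma rhoHat_pos (t : ℕ) : 0 < rhoHat t := by unfold rhoHat; positivity

lemma rhoHat_le_half (ht : 1 ≤ t) : rhoHat t ≤ 1 / 2 := by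
  unfold rhoHat
  calc ((1 : ℝ) / 2) ^ t ≤ (1 / 2) ^ 1 := pow_le_pow_of_le_one (by norm_num) (by norm_num) ht
    _ = 1 / 2 := pow_one _

lemma measurable_phiHat (t : ℕ) : Measurable fun ω : Draws H => phiHat D f ε δ₀ ω t := by
  have h : Measurable fun e : H × H => hypDist D f e.1 e.2 := .of_discrete
  unfold phiHat psi
  fun_prop

lemma log_four_div_pos (hδ : 0 < δ₀) (hδ' : δ₀ ≤ 1 / 4) : 0 < Real.log (4 / δ₀) :=
  Real.log_pos (by rw [lt_div_iff₀ hδ]; linarith)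

/-- Correctness of the test uses only the first term of the maximum. The term `40/Φ̂_t²` matters
only for the cost. -/
lemma le_sizeN {ω : Draws H} (hL : 0 ≤ Real.log (4 / δ₀)) (hv : 0 < phiHat D f ε δ₀ ω t) :
    32 * Real.log (4 / δ₀) ≤ sizeN D f ε δ₀ ω t * rhoHat t ^ 2 * phiHat D f ε δ₀ ω t := by
  have hs := rhoHat_pos t
  have h : 32 / (rhoHat t ^ 2 * phiHat D f ε δ₀ ω t) * Real.log (4 / δ₀) ≤ sizeN D f ε δ₀ ω t :=
    (mul_le_mul_of_nonneg_right (le_max_left _ _) hL).trans (Nat.le_ceil _)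
  rw [div_mul_eq_mul_div, div_le_iff₀ (by positivity)] at h
  linarith

lemma sizeN_pos {ω : Draws H} (hL : 0 < Real.log (4 / δ₀)) (hv : 0 < phiHat D f ε δ₀ ω t) :
    0 < sizeN D f ε δ₀ ω t := by
  rw [Nat.pos_iff_ne_zero]
  intro h0
  have h := le_sizeN hL.le hv
  rw [h0, Nat.cast_zero, zero_mul, zero_mul] at h
  linarith

/-- In round `t` the estimate `Φ̂_t` has relative error less than `ρ̂_t / 4`. -/
def Accurate (D : Measure X) (f : H → X → Bool) (π : Measure H) (V : Set H) (ε δ₀ : ℝ)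
    (ω : Draws H) (t : ℕ) : Prop :=
  |phiHat D f ε δ₀ ω t - avgDiam D f π V| < avgDiam D f π V * rhoHat t / 4

lemma Accurate.bounds {ω : Draws H} (h : Accurate D f π V ε δ₀ ω t) :
    avgDiam D f π V - avgDiam D f π V * rhoHat t / 4 < phiHat D f ε δ₀ ω t ∧
      phiHat D f ε δ₀ ω t < avgDiam D f π V + avgDiam D f π V * rhoHat t / 4 := by
  obtain ⟨h1, h2⟩ := abs_lt.1 h
  constructor <;> linarith

lemma Accurate.lower {ω : Draws H} (h : Accurate D f π V ε δ₀ ω t) (ht : 1 ≤ t) :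
    7 / 8 * avgDiam D f π V < phiHat D f ε δ₀ ω t := by
  have h1 := h.bounds.1
  have h2 := mul_le_mul_of_nonneg_left (rhoHat_le_half ht) 
    (avgDiam_nonneg (D := D) (f := f) (π := π) V)
  linarith

variable [IsProbabilityMeasure D]

lemma measureReal_not_accurate_le (hV : π V ≠ 0) (hε : 0 < ε) (hεΦ : ε ≤ avgDiam D f π V)
    (hδ : 0 < δ₀) (hδ' : δ₀ ≤ 1 / 4) (t : ℕ) :
    (drawsLaw π V hV).real {ω | ¬ Accurate D f π V ε δ₀ ω t} ≤ δ₀ / 2 := by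
  have := isProbabilityMeasure_pairLaw hV
  set Φ := avgDiam D f π V with hΦdef
  set L := Real.log (4 / δ₀) with hLdef
  set M := sizeM ε δ₀ t
  have hL : 0 < L := log_four_div_pos hδ hδ'
  have hs0 : 0 < rhoHat t := rhoHat_pos t
  have hs1 : rhoHat t ≤ 1 := pow_le_one₀ (by norm_num) (by norm_num)
  have hM : 48 * L ≤ M * rhoHat t ^ 2 * Φ := by
    have h : 48 / (rhoHat t ^ 2 * ε) * L ≤ M := Nat.le_ceil _
    rw [div_mul_eq_mul_div, div_le_iff₀ (by positivity)] at h
    calc 48 * L ≤ M * (rhoHat t ^ 2 * ε) := h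
      _ ≤ M * (rhoHat t ^ 2 * Φ) := by gcongr
      _ = _ := by ring
  have hM0 : (0 : ℝ) < M := by
    rcases Nat.eq_zero_or_pos M with h | h
    · rw [h, Nat.cast_zero, zero_mul, zero_mul] at hM; linarith
    · exact_mod_cast h
  let S : (ℕ × ℕ → H × H) → ℝ := fun a =>
    ∑ i ∈ Finset.range M, hypDist D f (a (t, i)).1 (a (t, i)).2
  have hexpL : Real.exp (-L) = δ₀ / 4 := by
    rw [Real.exp_neg, hLdef, Real.exp_log (by positivity), inv_div]
  have htail : ∀ l a : ℝ, (l = rhoHat t / 6 ∧ a = M * (Φ + Φ * rhoHat t / 4) ∨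
      l = -(rhoHat t / 6) ∧ a = M * (Φ - Φ * rhoHat t / 4)) →
      (drawsLaw π V hV).real {ω | l * a ≤ l * S ω.1} ≤ δ₀ / 4 := fun l a hla => by
    -- The estimate reads only the first family of draws.
    have hset : {ω : Draws H | l * a ≤ l * S ω.1} = {b | l * a ≤ l * S b} ×ˢ Set.univ := by
      ext; simp
    rw [hset, drawsLaw, measureReal_prod_prod, probReal_univ, mul_one, ← hexpL]
    refine (measureReal_le_exp_of_iid (Y := fun e : H × H => hypDist D f e.1 e.2) .of_discrete
      (fun _ => hypDist_nonneg _ _) (fun _ => hypDist_le_one _ _) (Prod.mk_right_injective t) M l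
      a).trans ?_
    exact Real.exp_le_exp.2
      (exponent_estimate_le hs0 hs1 (hε.le.trans hεΦ) hM0.le hM hla)
  have hsub : {ω | ¬ Accurate D f π V ε δ₀ ω t} ⊆
      {ω | rhoHat t / 6 * (M * (Φ + Φ * rhoHat t / 4)) ≤ rhoHat t / 6 * S ω.1} ∪
      {ω | -(rhoHat t / 6) * (M * (Φ - Φ * rhoHat t / 4)) ≤ -(rhoHat t / 6) * S ω.1} := by
    intro ω hω
    have hv : phiHat D f ε δ₀ ω t * M = S ω.1 := div_mul_cancel₀ _ hM0.ne'
    simp only [Accurate, Set.mem_ofPred_eq, not_lt, le_abs, ← hΦdef] at hω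
    rcases hω with h | h
    · left
      refine mul_le_mul_of_nonneg_left ?_ (by linarith : 0 ≤ rhoHat t / 6)
      rw [← hv, mul_comm]
      exact mul_le_mul_of_nonneg_right (by linarith) hM0.le
    · right
      refine mul_le_mul_of_nonpos_left ?_ (by linarith : -(rhoHat t / 6) ≤ 0)
      rw [← hv, mul_comm (M : ℝ)]
      exact mul_le_mul_of_nonneg_right (by linarith) hM0.le
  have : IsProbabilityMeasure (drawsLaw π V hV) := by unfold drawsLaw; infer_instance
  calc _ ≤ _ := measureReal_mono hsub
    _ ≤ _ := measureReal_union_le _ _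
    _ ≤ δ₀ / 4 + δ₀ / 4 := add_le_add (htail _ _ (.inl ⟨rfl, rfl⟩)) (htail _ _ (.inr ⟨rfl, rfl⟩))
    _ = δ₀ / 2 := by ring

/-- If the Chernoff exponent of the test statistic is at most `-ln (4 / δ₀)` for each accurate
value of `Φ̂_t`, then the test of round `t` errs with probability at most `δ₀ / 4`. -/
lemma measureReal_test_le (hV : π V ≠ 0) (hΦ : 0 < avgDiam D f π V)
    (hδ : 0 < δ₀) (hδ' : δ₀ ≤ 1 / 4) (ht : 1 ≤ t) (x : X) (b : Bool) (l : ℝ)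
    (hl : ∀ v n : ℝ, avgDiam D f π V - avgDiam D f π V * rhoHat t / 4 ≤ v →
      v ≤ avgDiam D f π V + avgDiam D f π V * rhoHat t / 4 → 0 ≤ n →
      32 * Real.log (4 / δ₀) ≤ n * rhoHat t ^ 2 * v →
      n * ((∫ e, edgeWeight D f x b e ∂(pairLaw π V)) * (Real.exp l - 1)) -
        l * (n * ((1 - rhoHat t) * v)) ≤ -Real.log (4 / δ₀)) :
    (drawsLaw π V hV).real {ω | Accurate D f π V ε δ₀ ω t ∧
      l * (sizeN D f ε δ₀ ω t * ((1 - rhoHat t) * phiHat D f ε δ₀ ω t)) ≤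
        l * ∑ i ∈ Finset.range (sizeN D f ε δ₀ ω t), edgeWeight D f x b (ω.2 (t, i))} ≤
      δ₀ / 4 := by
  have := isProbabilityMeasure_pairLaw hV
  have hφ := measurable_phiHat (D := D) (f := f) (ε := ε) (δ₀ := δ₀) t
  have hw : Measurable (edgeWeight D f x b) := .of_discrete
  have hN : Measurable fun ω : Draws H => sizeN D f ε δ₀ ω t := by
    unfold sizeN; fun_prop
  have hsum : Measurable fun ω : Draws H =>
      ∑ i ∈ Finset.range (sizeN D f ε δ₀ ω t), edgeWeight D f x b (ω.2 (t, i)) := by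
    -- The number of summands is random, so it is first made a separate variable ranging over a
    -- countable space.
    have h : Measurable fun q : Draws H × ℕ =>
        ∑ i ∈ Finset.range q.2, edgeWeight D f x b (q.1.2 (t, i)) :=
      measurable_from_prod_countable_left fun n =>
        Finset.measurable_fun_sum (Finset.range n) fun i _ => by fun_prop
    exact h.comp (measurable_id.prodMk hN)
  refine measureReal_prod_le_of_slice ?_ (by positivity) fun a => ?_
  · refine (measurableSet_lt (f := fun ω : Draws H => |phiHat D f ε δ₀ ω t - avgDiam D f π V|)
      (by fun_prop) measurable_const).inter (measurableSet_le ?_ (hsum.const_mul l))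
    have hN' : Measurable fun ω : Draws H => (sizeN D f ε δ₀ ω t : ℝ) :=
      measurable_from_top.comp hN
    fun_prop
  -- The second component is filler: `phiHat` and `sizeN` depend on the first one only.
  · set ω₀ : Draws H := (a, a)
    by_cases hacc : Accurate D f π V ε δ₀ ω₀ t
    · have hv : 0 < phiHat D f ε δ₀ ω₀ t := lt_trans (by positivity) (hacc.lower ht)
      refine (measureReal_mono (s₂ := {b' | l * (sizeN D f ε δ₀ ω₀ t *
        ((1 - rhoHat t) * phiHat D f ε δ₀ ω₀ t)) ≤ l * ∑ i ∈ Finset.range (sizeN D f ε δ₀ ω₀ t),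
          edgeWeight D f x b (b' (t, i))}) fun b' hb' => hb'.2).trans ?_
      refine (measureReal_le_exp_of_iid hw (edgeWeight_nonneg x b) (edgeWeight_le_one x b)
        (Prod.mk_right_injective t) _ l _).trans ?_
      calc _ ≤ Real.exp (-Real.log (4 / δ₀)) :=
            Real.exp_le_exp.2 (hl _ _ hacc.bounds.1.le hacc.bounds.2.le (Nat.cast_nonneg _)
              (le_sizeN (log_four_div_pos hδ hδ').le hv))
        _ = δ₀ / 4 := by rw [Real.exp_neg, Real.exp_log (by positivity), inv_div]
    · have hempty : {b' | (a, b') ∈ {ω | Accurate D f π V ε δ₀ ω t ∧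
          l * (sizeN D f ε δ₀ ω t * ((1 - rhoHat t) * phiHat D f ε δ₀ ω t)) ≤
          l * ∑ i ∈ Finset.range (sizeN D f ε δ₀ ω t),
            edgeWeight D f x b (ω.2 (t, i))}} = ∅ :=
        Set.eq_empty_of_forall_notMem fun b' hb' => hacc hb'.1
      rw [hempty, measureReal_empty]
      positivity

lemma measureReal_false_pass_le (hV : π V ≠ 0) (hΦ : 0 < avgDiam D f π V)
    (hδ : 0 < δ₀) (hδ' : δ₀ ≤ 1 / 4) (ht : 1 ≤ t) {x : X}
    (hx : ¬ AvgSplits D f π (rhoHat t / 2) V x) :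
    (drawsLaw π V hV).real {ω | Accurate D f π V ε δ₀ ω t ∧ Passes D f ε δ₀ ω t x} ≤ δ₀ / 4 := by
  have := isProbabilityMeasure_pairLaw hV
  have : IsProbabilityMeasure (drawsLaw π V hV) := by unfold drawsLaw; infer_instance
  rw [avgSplits_iff] at hx
  push Not at hx
  obtain ⟨b, hb⟩ := hx
  have hs := rhoHat_pos t
  refine (measureReal_mono fun ω hω => ?_).trans
    (measureReal_test_le hV hΦ hδ hδ' ht x b (-(rhoHat t / 4)) fun v n _ hv' hn0 hn =>
      exponent_lower_le hs (rhoHat_le_half ht) hΦ hb.le hv' hn0 hn)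
  have hv : 0 < phiHat D f ε δ₀ ω t := lt_trans (by positivity) (hω.1.lower ht)
  refine ⟨hω.1, mul_le_mul_of_nonpos_left ?_ (by linarith)⟩
  exact (passes_iff (sizeN_pos (log_four_div_pos hδ hδ') hv)).1 hω.2 b

lemma measureReal_false_fail_le (hV : π V ≠ 0) (hΦ : 0 < avgDiam D f π V)
    (hδ : 0 < δ₀) (hδ' : δ₀ ≤ 1 / 4) (ht : 1 ≤ t) {x : X}
    (hx : AvgSplits D f π (2 * rhoHat t) V x) :
    (drawsLaw π V hV).real {ω | Accurate D f π V ε δ₀ ω t ∧ ¬ Passes D f ε δ₀ ω t x} ≤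
      δ₀ / 2 := by
  have := isProbabilityMeasure_pairLaw hV
  have : IsProbabilityMeasure (drawsLaw π V hV) := by unfold drawsLaw; infer_instance
  rw [avgSplits_iff] at hx
  have hs := rhoHat_pos t
  have htail := fun b => measureReal_test_le (ε := ε) hV hΦ hδ hδ' ht x b (rhoHat t / 4)
    fun v n hv hv' hn0 hn => exponent_upper_le hs (rhoHat_le_half ht) hΦ (hx b) hv hv' hn0 hn
  refine (measureReal_mono fun ω hω => ?_).trans ((measureReal_union_le _ _).trans
    ((add_le_add (htail true) (htail false)).trans_eq (by ring)))
  have hv : 0 < phiHat D f ε δ₀ ω t := lt_trans (by positivity) (hω.1.lower ht)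
  have hnot := hω.2
  rw [passes_iff (sizeN_pos (log_four_div_pos hδ hδ') hv), Bool.forall_bool, not_and_or, not_le,
    not_le] at hnot
  rcases hnot with h | h
  · exact .inr ⟨hω.1, mul_le_mul_of_nonneg_left h.le (by linarith)⟩
  · exact .inl ⟨hω.1, mul_le_mul_of_nonneg_left h.le (by linarith)⟩

end Round

/-! ### The number of rounds and the sample size -/

lemma le_two_pow_ceil_logb {y : ℝ} (hy : 0 < y) : y ≤ 2 ^ ⌈Real.logb 2 y⌉₊ := by
  calc y = 2 ^ Real.logb 2 y := (Real.rpow_logb two_pos (by norm_num) hy).symm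
    _ ≤ 2 ^ (⌈Real.logb 2 y⌉₊ : ℝ) :=
      Real.rpow_le_rpow_of_exponent_le one_le_two (Nat.le_ceil _)
    _ = _ := Real.rpow_natCast _ _

lemma two_pow_ceil_logb_le {y : ℝ} (hy : 1 ≤ y) : 2 ^ ⌈Real.logb 2 y⌉₊ ≤ 2 * y := by
  have h := (Nat.ceil_lt_add_one (Real.logb_nonneg one_lt_two hy)).le
  calc (2 : ℝ) ^ ⌈Real.logb 2 y⌉₊ = 2 ^ (⌈Real.logb 2 y⌉₊ : ℝ) := (Real.rpow_natCast _ _).symm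
    _ ≤ 2 ^ (Real.logb 2 y + 1) := Real.rpow_le_rpow_of_exponent_le one_le_two h
    _ = 2 * y := by
      rw [Real.rpow_add two_pos, Real.rpow_logb two_pos (by norm_num) (by linarith), Real.rpow_one,
        mul_comm]

lemma two_mul_rhoHat_le {ρ : ℝ} (hρ : 0 < ρ) :
    2 * rhoHat (⌈Real.logb 2 (1 / ρ)⌉₊ + 1) ≤ ρ := by
  have h := le_two_pow_ceil_logb (one_div_pos.2 hρ)
  rw [rhoHat, pow_succ, one_div_pow]
  calc 2 * (1 / (2 : ℝ) ^ ⌈Real.logb 2 (1 / ρ)⌉₊ * (1 / 2)) =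
        1 / (2 : ℝ) ^ ⌈Real.logb 2 (1 / ρ)⌉₊ := by ring
    _ ≤ ρ := (one_div_le hρ (by positivity)).1 h

lemma le_rhoHat {ρ : ℝ} (hρ : 0 < ρ) (hρ1 : ρ ≤ 1) {t : ℕ}
    (ht : t ≤ ⌈Real.logb 2 (1 / ρ)⌉₊ + 1) : ρ / 4 ≤ rhoHat t := by
  have h := two_pow_ceil_logb_le (one_le_one_div hρ hρ1)
  rw [rhoHat]
  refine le_trans ?_ (pow_le_pow_of_le_one (by norm_num) (by norm_num) ht)
  rw [pow_succ, one_div_pow]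
  have : ρ / 2 ≤ 1 / (2 : ℝ) ^ ⌈Real.logb 2 (1 / ρ)⌉₊ := by
    rw [le_one_div (by positivity) (by positivity)]
    exact h.trans_eq (by field_simp)
  linarith

/-- Since `1/ρ̂_s² = 4^s`, the last round dominates the cost up to a constant factor. -/
lemma sum_Icc_four_pow_le (t : ℕ) : ∑ s ∈ Finset.Icc 1 t, (4 : ℝ) ^ s ≤ 4 / 3 * 4 ^ t := by
  induction t with
  | zero => norm_num
  | succ t ih => rw [Finset.sum_Icc_succ_top (by omega), pow_succ]; linarith

section Select

variable {X H : Type*} [MeasurableSpace X] [Fintype H] [MeasurableSpace H]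
  [DiscreteMeasurableSpace H] {D : Measure X} {f : H → X → Bool} {π : Measure H}
  [IsProbabilityMeasure π] {V : Set H} {ε δ₀ : ℝ} {t : ℕ}

lemma AvgSplits.mono {ρ ρ' : ℝ} {x : X} (h : AvgSplits D f π ρ V x) (hρ : ρ' ≤ ρ) :
    AvgSplits D f π ρ' V x :=
  h.trans (mul_le_mul_of_nonneg_right (by linarith) (avgDiam_nonneg (D := D) V))

lemma AvgSplits.le_one {ρ : ℝ} {x : X} (h : AvgSplits D f π ρ V x)
    (hΦ : 0 < avgDiam D f π V) : ρ ≤ 1 := by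
  have h0 : 0 ≤ (1 - ρ) * avgDiam D f π V :=
    (mul_nonneg (by positivity) (avgDiam_nonneg (D := D) _)).trans ((le_max_left _ _).trans h)
  linarith [nonneg_of_mul_nonneg_left h0 hΦ]

lemma one_div_rhoHat_sq (t : ℕ) : 1 / rhoHat t ^ 2 = 4 ^ t := by
  rw [rhoHat, ← pow_mul, mul_comm, pow_mul, one_div, ← inv_pow]
  norm_num

lemma sample_size_le [IsProbabilityMeasure D] {ω : Draws H} (hV : π V ≠ 0) (hε : 0 < ε)
    (hεΦ : ε ≤ avgDiam D f π V) (hL : 1 ≤ Real.log (4 / δ₀)) (ht : 1 ≤ t)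
    (hacc : Accurate D f π V ε δ₀ ω t) :
    2 * ((sizeM ε δ₀ t : ℝ) + sizeN D f ε δ₀ ω t) ≤
      Real.log (4 / δ₀) * (172 * (4 ^ t / ε) + 108 / avgDiam D f π V ^ 2) := by
  set Φ := avgDiam D f π V
  set v := phiHat D f ε δ₀ ω t 
  set L := Real.log (4 / δ₀)
  have hΦ : 0 < Φ := hε.trans_le hεΦ
  have hΦ1 : Φ ≤ 1 := avgDiam_le_one hV
  have hv : 7 / 8 * Φ < v := hacc.lower ht
  have hv0 : 0 < v := lt_trans (by positivity) hv
  have hs := rhoHat_pos t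
  have h4 : (1 : ℝ) ≤ 4 ^ t := one_le_pow₀ (by norm_num)
  have hA : 1 ≤ 4 ^ t / ε := by rw [one_le_div hε]; linarith
  have hB : 1 ≤ 1 / Φ ^ 2 := one_le_one_div (by positivity) (pow_le_one₀ hΦ.le hΦ1)
  have e1 : 48 / (rhoHat t ^ 2 * ε) = 48 * (4 ^ t / ε) := by
    rw [← one_div_rhoHat_sq]; field_simp
  have e2 : 32 / (rhoHat t ^ 2 * v) ≤ 37 * (4 ^ t / ε) := by
    calc 32 / (rhoHat t ^ 2 * v) ≤ 32 / (rhoHat t ^ 2 * (7 / 8 * ε)) := by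
          gcongr; linarith
      _ = 256 / 7 * (4 ^ t / ε) := by rw [← one_div_rhoHat_sq]; field_simp; norm_num
      _ ≤ _ := by linarith
  have e3 : 40 / v ^ 2 ≤ 53 * (1 / Φ ^ 2) := by
    calc 40 / v ^ 2 ≤ 40 / (7 / 8 * Φ) ^ 2 := by gcongr
      _ = 2560 / 49 * (1 / Φ ^ 2) := by field_simp; norm_num
      _ ≤ _ := by linarith
  have hm : (sizeM ε δ₀ t : ℝ) ≤ 48 * (4 ^ t / ε) * L + 1 := by
    rw [← e1]; exact (Nat.ceil_lt_add_one (by positivity)).le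
  have hn : (sizeN D f ε δ₀ ω t : ℝ) ≤ (37 * (4 ^ t / ε) + 53 * (1 / Φ ^ 2)) * L + 1 := by
    refine (Nat.ceil_lt_add_one (mul_nonneg (le_max_of_le_left (by positivity))
      (by linarith))).le.trans ?_
    gcongr
    exact max_le (by linarith) (by linarith)
  -- The two roundings up are absorbed one into each term: `172 = 2(48 + 37 + 1)` and `108 = 2(53 +
  -- 1)`.
  have h1 : 1 ≤ 4 ^ t / ε * L := one_le_mul_of_one_le_of_one_le hA hL
  have h2 : 1 ≤ 1 / Φ ^ 2 * L := one_le_mul_of_one_le_of_one_le hB hL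
  have e4 : (108 : ℝ) / Φ ^ 2 = 108 * (1 / Φ ^ 2) := by ring
  rw [e4]
  linarith

lemma numSampled_le [IsProbabilityMeasure D] {ω : Draws H} {ρ : ℝ} (hV : π V ≠ 0) (hε : 0 < ε)
    (hεΦ : ε ≤ avgDiam D f π V) (hδ : 0 < δ₀) (hδ' : δ₀ ≤ 1 / 4) (hρ : 0 < ρ) (hρ1 : ρ ≤ 1)
    (ht : t ≤ ⌈Real.logb 2 (1 / ρ)⌉₊ + 1)
    (hacc : ∀ s ∈ Finset.Icc 1 t, Accurate D f π V ε δ₀ ω s) :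
    (numSampled D f ε δ₀ ω t : ℝ) ≤
      10000 * ((1 / (ε * ρ ^ 2) + (1 + Real.logb 2 (1 / ρ)) / avgDiam D f π V ^ 2) *
        Real.log (1 / δ₀)) := by
  set Φ := avgDiam D f π V
  have hΦ : 0 < Φ := hε.trans_le hεΦ
  have hlog4 : Real.log 4 ≤ Real.log (1 / δ₀) :=
    Real.log_le_log (by norm_num) ((le_one_div (by norm_num) hδ).2 hδ')
  have hlog4' : 1 ≤ Real.log 4 := by
    rw [Real.le_log_iff_exp_le (by norm_num)]; linarith [Real.exp_one_lt_d9]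
  have hL : Real.log (4 / δ₀) = Real.log 4 + Real.log (1 / δ₀) := by
    rw [← Real.log_mul (by norm_num) (by positivity), mul_one_div]
  have hlogb : 0 ≤ Real.logb 2 (1 / ρ) := Real.logb_nonneg one_lt_two (one_le_one_div hρ hρ1)
  have ht' : (t : ℝ) ≤ 2 * (1 + Real.logb 2 (1 / ρ)) := by
    have h1 : (t : ℝ) ≤ ⌈Real.logb 2 (1 / ρ)⌉₊ + 1 := by exact_mod_cast ht
    linarith [Nat.ceil_lt_add_one hlogb]
  have h4t : (4 : ℝ) ^ t ≤ 16 / ρ ^ 2 := by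
    rw [← one_div_rhoHat_sq]
    calc 1 / rhoHat t ^ 2 ≤ 1 / (ρ / 4) ^ 2 := by gcongr; exact le_rhoHat hρ hρ1 ht
      _ = 16 / ρ ^ 2 := by field_simp; norm_num
  have hsum : ∑ s ∈ Finset.Icc 1 t, (172 * ((4 : ℝ) ^ s / ε) + 108 / Φ ^ 2) ≤
      4000 * (1 / (ε * ρ ^ 2) + (1 + Real.logb 2 (1 / ρ)) / Φ ^ 2) := by
    rw [Finset.sum_add_distrib, ← Finset.mul_sum, ← Finset.sum_div, Finset.sum_const, Nat.card_Icc,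
      nsmul_eq_mul, Nat.add_sub_cancel]
    have h1 : (∑ s ∈ Finset.Icc 1 t, (4 : ℝ) ^ s) / ε ≤ 64 / 3 * (1 / (ε * ρ ^ 2)) := by
      calc (∑ s ∈ Finset.Icc 1 t, (4 : ℝ) ^ s) / ε ≤ (4 / 3 * (16 / ρ ^ 2)) / ε := by
            gcongr; linarith [sum_Icc_four_pow_le t]
        _ = _ := by field_simp; norm_num
    have h2 : (t : ℝ) * (108 / Φ ^ 2) ≤ 216 * ((1 + Real.logb 2 (1 / ρ)) / Φ ^ 2) := by
      calc (t : ℝ) * (108 / Φ ^ 2) ≤ 2 * (1 + Real.logb 2 (1 / ρ)) * (108 / Φ ^ 2) := by gcongr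
        _ = _ := by ring
    have h3 : 0 ≤ 1 / (ε * ρ ^ 2) := by positivity
    have h4 : 0 ≤ (1 + Real.logb 2 (1 / ρ)) / Φ ^ 2 := by positivity
    linarith
  have hQ : 0 ≤ 1 / (ε * ρ ^ 2) + (1 + Real.logb 2 (1 / ρ)) / Φ ^ 2 := by positivity
  calc (numSampled D f ε δ₀ ω t : ℝ)
      = ∑ s ∈ Finset.Icc 1 t, 2 * ((sizeM ε δ₀ s : ℝ) + sizeN D f ε δ₀ ω s) := by
        simp [numSampled]
    _ ≤ ∑ s ∈ Finset.Icc 1 t, Real.log (4 / δ₀) * (172 * (4 ^ s / ε) + 108 / Φ ^ 2) :=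
        Finset.sum_le_sum fun s hs => sample_size_le hV hε hεΦ (by linarith)
          (Finset.mem_Icc.1 hs).1 (hacc s hs)
    _ ≤ (2 * Real.log (1 / δ₀)) *
          (4000 * (1 / (ε * ρ ^ 2) + (1 + Real.logb 2 (1 / ρ)) / Φ ^ 2)) := by
        rw [← Finset.mul_sum]
        refine mul_le_mul (by linarith) hsum
          (Finset.sum_nonneg fun _ _ => by positivity) (by linarith)
    _ ≤ _ := by
        have := mul_nonneg hQ (show 0 ≤ Real.log (1 / δ₀) by linarith)
        linarith

/-- If `Φ̂_t` is accurate in the rounds `1, …, T`, no bad point passes in these rounds and some point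
passes in round `T`, then SELECT halts within `T` rounds and returns a good point. -/
lemma exists_haltsAt {m : ℕ} {x : Fin m → X} {ω : Draws H} {T : ℕ} {ρ : ℝ} (hT : 1 ≤ T)
    (hΦ : 0 < avgDiam D f π V)
    (hacc : ∀ s ∈ Finset.Icc 1 T, Accurate D f π V ε δ₀ ω s)
    (hgood : ∀ s ∈ Finset.Icc 1 T, ∀ i, Passes D f ε δ₀ ω s (x i) → AvgSplits D f π ρ V (x i))
    (hpass : ∃ i, Passes D f ε δ₀ ω T (x i)) :
    ∃ t ≤ T, HaltsAt D f ε δ₀ x ω t ∧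
      ∀ i, Returns D f ε δ₀ x ω t i → AvgSplits D f π ρ V (x i) := by
  classical
  -- SELECT halts in the first passing round, possibly before `T`. Accuracy keeps the estimates
  -- positive, so no round up to then is endless.
  have hex : ∃ t, 1 ≤ t ∧ ∃ i, Passes D f ε δ₀ ω t (x i) := ⟨T, hT, hpass⟩
  have hle : Nat.find hex ≤ T := Nat.find_min' hex ⟨hT, hpass⟩
  obtain ⟨h1, h2⟩ := Nat.find_spec hex
  refine ⟨Nat.find hex, hle, ⟨h1, fun s hs => ?_, fun s hs i hi => ?_, h2⟩, fun i hi =>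
    hgood _ (Finset.mem_Icc.2 ⟨h1, hle⟩) i hi.2⟩
  · rw [Finset.mem_Icc] at hs
    exact lt_trans (by positivity) ((hacc s (Finset.mem_Icc.2 ⟨hs.1, hs.2.trans hle⟩)).lower hs.1)
  · rw [Finset.mem_Ico] at hs
    exact Nat.find_min hex hs.2 ⟨hs.1, i, hi⟩

/-! ### Union bound over rounds and points -/

lemma measureReal_failure_le [IsProbabilityMeasure D] (hV : π V ≠ 0) {m : ℕ} {x : Fin m → X}
    {ρ : ℝ} {T : ℕ} (hε : 0 < ε) (hεΦ : ε ≤ avgDiam D f π V) (hδ : 0 < δ₀) (hδ' : δ₀ ≤ 1 / 4)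
    (hT : 1 ≤ T) (hTρ : 2 * rhoHat T ≤ ρ) (hρT : ∀ t ≤ T, ρ / 4 ≤ rhoHat t) {i₀ : Fin m} (hi₀ : AvgSplits D f π ρ V (x i₀)) :
    (drawsLaw π V hV).real
      {ω | ¬ ((∀ s ∈ Finset.Icc 1 T, Accurate D f π V ε δ₀ ω s) ∧
        (∀ s ∈ Finset.Icc 1 T, ∀ i, Passes D f ε δ₀ ω s (x i) →
          AvgSplits D f π (ρ / 8) V (x i)) ∧
        Passes D f ε δ₀ ω T (x i₀))} ≤
      T * (δ₀ / 2 + m * (δ₀ / 4)) + δ₀ / 2 := by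
  have := isProbabilityMeasure_pairLaw hV
  have : IsProbabilityMeasure (drawsLaw π V hV) := by unfold drawsLaw; infer_instance
  have hΦ : 0 < avgDiam D f π V := hε.trans_le hεΦ
  let A : ℕ → Set (Draws H) := fun s => {ω | ¬ Accurate D f π V ε δ₀ ω s}
  let B : ℕ → Fin m → Set (Draws H) := fun s i =>
    {ω | Accurate D f π V ε δ₀ ω s ∧ Passes D f ε δ₀ ω s (x i) ∧
      ¬ AvgSplits D f π (ρ / 8) V (x i)}
  let G : Set (Draws H) := {ω | Accurate D f π V ε δ₀ ω T ∧ ¬ Passes D f ε δ₀ ω T (x i₀)}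
  have hA : ∀ s, (drawsLaw π V hV).real (A s) ≤ δ₀ / 2 := fun s =>
    measureReal_not_accurate_le hV hε hεΦ hδ hδ' s
  have hB : ∀ s ∈ Finset.Icc 1 T, ∀ i, (drawsLaw π V hV).real (B s i) ≤ δ₀ / 4 :=
    fun s hs i => by
      rw [Finset.mem_Icc] at hs
      by_cases hi : AvgSplits D f π (ρ / 8) V (x i)
      · have : B s i = ∅ := Set.eq_empty_of_forall_notMem fun ω hω => hω.2.2 hi
        rw [this, measureReal_empty]; positivity
      -- From `ρ/4 ≤ ρ̂_s` follows `ρ/8 ≤ ρ̂_s/2`, so the point does not `(ρ̂_s/2)`-average split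
      -- either.
      · have hs4 := hρT s hs.2
        exact (measureReal_mono fun ω hω => And.intro hω.1 hω.2.1).trans
          (measureReal_false_pass_le hV hΦ hδ hδ' hs.1 fun h => hi (h.mono (by linarith)))
  have hG : (drawsLaw π V hV).real G ≤ δ₀ / 2 :=
    measureReal_false_fail_le hV hΦ hδ hδ' hT (hi₀.mono hTρ)
  have hround : ∀ s ∈ Finset.Icc 1 T,
      (drawsLaw π V hV).real (A s ∪ ⋃ i ∈ Finset.univ, B s i) ≤ δ₀ / 2 + m * (δ₀ / 4) :=
    fun s hs => by
      refine (measureReal_union_le _ _).trans (add_le_add (hA s) ?_)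
      calc _ ≤ ∑ i, (drawsLaw π V hV).real (B s i) := measureReal_biUnion_finset_le _ _
        _ ≤ ∑ _i : Fin m, δ₀ / 4 := Finset.sum_le_sum fun i _ => hB s hs i
        _ = m * (δ₀ / 4) := by
          rw [Finset.sum_const, Finset.card_univ, Fintype.card_fin, nsmul_eq_mul]
  have hrounds : (drawsLaw π V hV).real (⋃ s ∈ Finset.Icc 1 T, (A s ∪ ⋃ i ∈ Finset.univ, B s i)) ≤
      T * (δ₀ / 2 + m * (δ₀ / 4)) := by
    calc _ ≤ ∑ s ∈ Finset.Icc 1 T, (drawsLaw π V hV).real (A s ∪ ⋃ i ∈ Finset.univ, B s i) :=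
          measureReal_biUnion_finset_le _ _
      _ ≤ ∑ _s ∈ Finset.Icc 1 T, (δ₀ / 2 + m * (δ₀ / 4)) := Finset.sum_le_sum hround
      _ = _ := by rw [Finset.sum_const, Nat.card_Icc, Nat.add_sub_cancel, nsmul_eq_mul]
  refine le_trans (measureReal_mono ?_)
    ((measureReal_union_le _ _).trans (add_le_add hrounds hG))
  intro ω hω
  by_contra hcon
  simp only [Set.mem_union, Set.mem_iUnion, not_or, not_exists] at hcon
  obtain ⟨hcon, hconG⟩ := hcon
  have hacc : ∀ s ∈ Finset.Icc 1 T, Accurate D f π V ε δ₀ ω s := fun s hs =>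
    not_not.1 (hcon s hs).1
  refine hω ⟨hacc, fun s hs i hi => ?_, ?_⟩
  · by_contra hni
    exact (hcon s hs).2 i (Finset.mem_univ _) ⟨hacc s hs, hi, hni⟩
  · by_contra hni
    exact hconG ⟨hacc T (Finset.mem_Icc.2 ⟨hT, le_rfl⟩), hni⟩

/-- Subadditivity on a cover of the space suffices, so neither event has to be measurable. -/
lemma one_sub_le_measureReal {α : Type*} [MeasurableSpace α] {μ : Measure α}
    [IsProbabilityMeasure μ] {p q : α → Prop} {η : ℝ} (hpq : ∀ a, p a → q a)
    (h : μ.real {a | ¬ p a} ≤ η) : 1 - η ≤ μ.real {a | q a} := by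
  have hun : {a | q a} ∪ {a | ¬ p a} = Set.univ :=
    Set.eq_univ_of_forall fun a => (em (p a)).imp (hpq a) id
  have := measureReal_union_le (μ := μ) {a | q a} {a | ¬ p a}
  rw [hun, probReal_univ] at this
  linarith

lemma confidence_le_quarter {m : ℕ} {ℓ δ : ℝ} (hm : 1 ≤ m) (hℓ : 0 ≤ ℓ) (hδ : δ < 1)
    (h : δ₀ * (2 * m * (2 + ℓ)) ≤ δ) (hδ₀ : 0 < δ₀) : δ₀ ≤ 1 / 4 := by
  have hm' : (1 : ℝ) ≤ m := by exact_mod_cast hm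
  have : 4 ≤ 2 * m * (2 + ℓ) := by nlinarith
  nlinarith

end Select

end QuerySelection

theorem mainTheorem3 :
    ∃ C : ℝ, 0 < C ∧
      ∀ {X H : Type*} [MeasurableSpace X] [Fintype H] [MeasurableSpace H]
        [DiscreteMeasurableSpace H]
        (D : Measure X) [IsProbabilityMeasure D]
        (f : H → X → Bool) (_ : ∀ h, Measurable (f h))
        (π : Measure H) [IsProbabilityMeasure π]
        (V : Set H) (hV : π V ≠ 0) (m : ℕ) (x : Fin m → X) (ε ρ δ δ₀ : ℝ),
        0 < ε → ε ≤ QuerySelection.avgDiam D f π V →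
        0 < ρ → (∃ i, QuerySelection.AvgSplits D f π ρ V (x i)) →
        0 < δ → δ < 1 →
        0 < δ₀ → δ₀ ≤ δ / (2 * m * (2 + Real.logb 2 (1 / ρ))) →
        1 - δ ≤ (QuerySelection.drawsLaw π V hV).real
          {ω | ∃ t : ℕ,
            QuerySelection.HaltsAt D f ε δ₀ x ω t ∧
            (∀ i, QuerySelection.Returns D f ε δ₀ x ω t i →
              QuerySelection.AvgSplits D f π (ρ / 8) V (x i)) ∧
            t ≤ ⌈Real.logb 2 (1 / ρ)⌉₊ + 1 ∧
            (QuerySelection.numSampled D f ε δ₀ ω t : ℝ) ≤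
              C * ((1 / (ε * ρ ^ 2) +
                (1 + Real.logb 2 (1 / ρ)) / QuerySelection.avgDiam D f π V ^ 2) *
                Real.log (1 / δ₀))} := by
  refine ⟨10000, by norm_num, ?_⟩
  intro X H _ _ _ _ D _ f _ π _ V hV m x ε ρ δ δ₀ hε hεΦ hρ ⟨i₀, hi₀⟩ hδ hδ1 hδ₀ hle
  have := QuerySelection.isProbabilityMeasure_pairLaw hV
  have : IsProbabilityMeasure (QuerySelection.drawsLaw π V hV) := by
    unfold QuerySelection.drawsLaw; infer_instance
  have hΦ := hε.trans_le hεΦ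
  have hρ1 : ρ ≤ 1 := hi₀.le_one hΦ
  have hℓ : 0 ≤ Real.logb 2 (1 / ρ) := Real.logb_nonneg one_lt_two (one_le_one_div hρ hρ1)
  have hm : 1 ≤ m := i₀.pos
  have hm' : (1 : ℝ) ≤ m := by exact_mod_cast hm
  rw [le_div_iff₀ (by positivity)] at hle
  have hδ₀' := QuerySelection.confidence_le_quarter hm hℓ hδ1 hle hδ₀
  have hfail := QuerySelection.measureReal_failure_le (x := x) hV hε hεΦ hδ₀ hδ₀'
    (Nat.le_add_left 1 _) (QuerySelection.two_mul_rhoHat_le hρ)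
    (fun _ => QuerySelection.le_rhoHat hρ hρ1) hi₀
  have hT : ((⌈Real.logb 2 (1 / ρ)⌉₊ + 1 : ℕ) : ℝ) ≤ 2 + Real.logb 2 (1 / ρ) := by
    push_cast
    linarith [Nat.ceil_lt_add_one hℓ]
  -- As `m ≥ 1`, the left side is at most `(2 + log₂(1/ρ)) m δ₀`, half of what the hypothesis on
  -- `δ₀` allows.
  have hbound : ((⌈Real.logb 2 (1 / ρ)⌉₊ + 1 : ℕ) : ℝ) * (δ₀ / 2 + m * (δ₀ / 4)) + δ₀ / 2 ≤ δ := by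
    have h1 : (2 + Real.logb 2 (1 / ρ)) * δ₀ ≤ (2 + Real.logb 2 (1 / ρ)) * (m * δ₀) := by
      gcongr
      exact le_mul_of_one_le_left hδ₀.le hm'
    have h2 := mul_le_mul_of_nonneg_right hT (by positivity : 0 ≤ δ₀ / 2 + m * (δ₀ / 4))
    have h3 : 0 ≤ Real.logb 2 (1 / ρ) * (m * δ₀) := by positivity
    have h4 : 0 ≤ Real.logb 2 (1 / ρ) * δ₀ := by positivity
    nlinarith
  refine QuerySelection.one_sub_le_measureReal (fun ω hω => ?_) (hfail.trans hbound)
  obtain ⟨hacc, hgood, hpass⟩ := hω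
  obtain ⟨t, ht, hhalt, hret⟩ :=
    QuerySelection.exists_haltsAt (Nat.le_add_left 1 _) hΦ hacc hgood ⟨i₀, hpass⟩
  exact ⟨t, hhalt, hret, ht, QuerySelection.numSampled_le hV hε hεΦ hδ₀ hδ₀' hρ hρ1 ht
    fun s hs => hacc s (Finset.Icc_subset_Icc_right ht hs)⟩
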